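/- Let $p>1$, $\theta\in(0,1)$, let $D\in C^1(0,1)$ with $D>0$ in $(0,1)$, let $H\in C^1[0,1]$ with $H(0)=0$, $H>0$ in $(0,1]$ and $h=H'$, and let $g\in C[0,1]$ with $g=0$ in $[0,\theta]$, $g>0$ in $(\theta,1)$ and $g(1)=0$. Let $c>0$ and let $u:\mathbb R\to[0,1]$ be a solution of $$\bigl(D(u)|u'|^{p-2}u'\bigr)'+(c+h(u))u'+g(u)=0,\qquad u(-\infty)=1,\quad u(+\infty)=0,$$ in the following sense: $u$ is continuous; $u$ is $C^1$ on the open set $I_u=\{\xi: 0<u(\xi)<1\}$ and the equation holds at every point of $I_u$; the flux $\xi\mapsto D(u(\xi))|u'(\xi)|^{p-2}u'(\xi)$ (understood as $0$ outside $I_u$) is continuous on $\mathbb R$ and tends to $0$ as $u(\xi)\to0$ and as $u(\xi)\to1$; $u(\xi)\to1$ as $\xi\to-\infty$ and $u(\xi)\to0$ as $\xi\to+\infty$. Put $\xi_1=\inf I_u\in[-\infty,+\infty)$. Assume that $\lim_{v\to1-}D(v)/(1-v)^{\beta}$ and $\lim_{v\to1-}g(v)/(1-v)^{\gamma}$ exist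 and lie in $(0,+\infty)$, where $\beta\in\mathbb R$ and $\gamma>0$ satisfy $$-1<\gamma+\frac{\beta}{p-1}\le\frac1{p-1}.$$ If $\frac{\gamma-\beta+1}{p}<1$, then $\xi_1>-\infty$ and $u\equiv1$ on $(-\infty,\xi_1]$, so the profile reaches $1$ at a finite point. If $\frac{\gamma-\beta+1}{p}\ge1$, then $\xi_1=-\infty$ and $u<1$ on all of $\mathbb R$. -/

import Mathlib

open Set Filter Topology

noncomputable section

/-- `φ₁ ∼ φ₂` along the filter `l`: the quotient `φ₁ / φ₂` has a limit in `(0, +∞)`. -/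
def SimilarAlong (l : Filter ℝ) (φ₁ φ₂ : ℝ → ℝ) : Prop :=
  ∃ L : ℝ, 0 < L ∧ Tendsto (fun s => φ₁ s / φ₂ s) l (𝓝 L)

/-- The convective velocity `h = H'` on `[0, 1]` (one-sided derivatives at the endpoints). -/
def convVelocity (H : ℝ → ℝ) (v : ℝ) : ℝ := derivWithin H (Icc 0 1) v

/-- The set `I_u` of the points at which the profile lies strictly between the equilibria. -/
def transitionSet (u : ℝ → ℝ) : Set ℝ := {ξ | 0 < u ξ ∧ u ξ < 1}

/-- The flux `D(u) |u'|^(p-2) u'`. If `u` has values in `[0, 1]`, a point outside `I_u` is a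
global extremum of `u`, so `deriv u` vanishes there and the flux is `0`, whatever the values of
`D` at `0` and `1` are. -/
def waveFlux (p : ℝ) (D u : ℝ → ℝ) (ξ : ℝ) : ℝ :=
  D (u ξ) * |deriv u ξ| ^ (p - 2) * deriv u ξ

/-- `u` is a solution of
`(D(u) |u'|^(p-2) u')' + (c + h(u)) u' + g(u) = 0`, `u(-∞) = 1`, `u(+∞) = 0`. -/
structure IsWaveProfile (p c : ℝ) (D H g u : ℝ → ℝ) : Prop where
  continuous : Continuous u
  mem_Icc : ∀ ξ, u ξ ∈ Icc (0 : ℝ) 1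
  contDiffOn : ContDiffOn ℝ 1 u (transitionSet u)
  flux_differentiableAt : ∀ ξ ∈ transitionSet u, DifferentiableAt ℝ (waveFlux p D u) ξ
  equation : ∀ ξ ∈ transitionSet u,
    deriv (waveFlux p D u) ξ + (c + convVelocity H (u ξ)) * deriv u ξ + g (u ξ) = 0
  flux_continuous : Continuous (waveFlux p D u)
  /-- the flux tends to `0` as `u(ξ) → 0` -/
  flux_zero : Tendsto (waveFlux p D u) (comap u (𝓝 0)) (𝓝 0)
  /-- the flux tends to `0` as `u(ξ) → 1` -/
  flux_one : Tendsto (waveFlux p D u) (comap u (𝓝 1)) (𝓝 0)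
  tendsto_atBot : Tendsto u atBot (𝓝 1)
  tendsto_atTop : Tendsto u atTop (𝓝 0)

/-- `ξ₁ ∈ [-∞, +∞]`, the left endpoint of `I_u = (ξ₁, ξ₂)`. -/
def leftEndpoint (u : ℝ → ℝ) : EReal :=
  sInf ((fun ξ : ℝ => (ξ : EReal)) '' transitionSet u)

end

/-! Near the equilibrium `1` put `w = 1 - u`, and let `y` be minus the flux. The equation becomes
`y' = g - (c + h) w'` with `y ≍ w ^ β * w' ^ (p - 1)` and `g ≍ w ^ γ`. Inserting `w' ≍ w ^ δ` and
balancing `y'` against `g` forces `δ = (γ - β + 1) / p` and `y ≍ w ^ κ` with `κ = γ + 1 - δ`; the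
standing inequalities on `γ + β / (p - 1)` say exactly that `0 < κ ≤ 1`. Comparing `y` with large
and small multiples of `w ^ κ` turns this heuristic into the two-sided bound `w' ≍ w ^ δ`. Hence
`w` vanishes at a finite point if `δ < 1`, by separation of variables, and cannot do so if
`1 ≤ δ`, by Gronwall's inequality. -/

theorem le_of_deriv_lt_of_tendsto_sub {S : Set ℝ} (hS : S.OrdConnected) {f f' g g' : ℝ → ℝ}
    (hf : ∀ x ∈ S, HasDerivAt f (f' x) x) (hg : ∀ x ∈ S, HasDerivAt g (g' x) x)
    (hlt : ∀ x ∈ S, g x < f x → f' x < g' x)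
    (hlim : Tendsto (fun x : S => f x - g x) atBot (𝓝 0)) {x : ℝ} (hx : x ∈ S) : f x ≤ g x := by
  refine le_of_forall_pos_le_add fun ε hε => ?_
  have : Nonempty S := ⟨⟨x, hx⟩⟩
  obtain ⟨⟨t, ht⟩, htε, htx⟩ :=
    ((hlim.eventually_lt_const hε).and (eventually_le_atBot ⟨x, hx⟩)).exists
  have hsub : Icc t x ⊆ S := hS.out ht hx
  have hgε : ∀ s ∈ Icc t x, HasDerivAt (fun s => g s + ε) (g' s) s := fun s hs =>
    (hg s (hsub hs)).add_const ε
  refine image_le_of_deriv_right_lt_deriv_boundary'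
    (fun s hs => (hf s (hsub hs)).continuousAt.continuousWithinAt)
    (fun s hs => (hf s (hsub (Ico_subset_Icc_self hs))).hasDerivWithinAt) (by linarith)
    (fun s hs => (hgε s hs).continuousAt.continuousWithinAt)
    (fun s hs => (hgε s (Ico_subset_Icc_self hs)).hasDerivWithinAt)
    (fun s hs hfg => hlt s (hsub (Ico_subset_Icc_self hs)) (by linarith)) (right_mem_Icc.2 htx)

theorem not_forall_mul_rpow_le_deriv {w : ℝ → ℝ} {A k δ : ℝ} (hw : ∀ x < A, 0 < w x)
    (hk : 0 < k) (hδ : δ < 1) : ¬ ∀ x < A, k * w x ^ δ ≤ deriv w x := by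
  intro hle
  have hderiv : ∀ x < A, HasDerivAt (fun t => w t ^ (1 - δ))
      (deriv w x * (1 - δ) * w x ^ (1 - δ - 1)) x := fun x hx => by
    have hpos : 0 < deriv w x := (mul_pos hk (Real.rpow_pos_of_pos (hw x hx) δ)).trans_le (hle x hx)
    exact (differentiableAt_of_deriv_ne_zero hpos.ne').hasDerivAt.rpow_const (.inl (hw x hx).ne')
  set B := k * (1 - δ)
  have hB : 0 < B := mul_pos hk (by linarith)
  have hBle : ∀ x < A, B ≤ deriv (fun t => w t ^ (1 - δ)) x := fun x hx => by
    have h0 := hw x hx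
    calc B = k * w x ^ δ * (1 - δ) * w x ^ (1 - δ - 1) := by
          rw [mul_right_comm k, mul_assoc, ← Real.rpow_add h0]; simp [B]
      _ ≤ deriv w x * (1 - δ) * w x ^ (1 - δ - 1) := by
          have := hle x hx
          have : 0 ≤ 1 - δ := by linarith
          gcongr
      _ = _ := ((hderiv x hx).deriv).symm
  set x₀ := A - 1
  have hx₀ : x₀ < A := sub_one_lt A
  set L := w x₀ ^ (1 - δ) / B
  have hL : 0 < L := div_pos (Real.rpow_pos_of_pos (hw x₀ hx₀) _) hB
  have hLB : B * L = w x₀ ^ (1 - δ) := mul_div_cancel₀ _ hB.ne'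
  have hx₁ : x₀ - L < A := by linarith
  have hint : ∀ x ∈ interior (Iio A), x < A := fun x hx => mem_Iio.1 (interior_subset hx)
  have hgrowth := (convex_Iio A).mul_sub_le_image_sub_of_le_deriv
    (fun x hx => (hderiv x hx).continuousAt.continuousWithinAt)
    (fun x hx => (hderiv x (hint x hx)).differentiableAt.differentiableWithinAt)
    (fun x hx => hBle x (hint x hx)) (x₀ - L) hx₁ x₀ hx₀ (by linarith)
  have hpos := Real.rpow_pos_of_pos (hw _ hx₁) (1 - δ)
  rw [sub_sub_cancel, hLB] at hgrowth
  linarith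

theorem eq_zero_of_norm_deriv_le_of_tendsto {E : Type*} [NormedAddCommGroup E] [NormedSpace ℝ E]
    {f f' : ℝ → E} {a b K : ℝ} (hf : ∀ x ∈ Ioo a b, HasDerivAt f (f' x) x)
    (hbound : ∀ x ∈ Ioo a b, ‖f' x‖ ≤ K * ‖f x‖) (hlim : Tendsto f (𝓝[>] a) (𝓝 0))
    {x : ℝ} (hx : x ∈ Ioo a b) : f x = 0 := by
  have hgronwall : ∀ t ∈ Ioo a x, ‖f x‖ ≤ ‖f t‖ * Real.exp (K * (x - t)) := fun t ht => by
    have hsub : Icc t x ⊆ Ioo a b := fun s hs => ⟨ht.1.trans_le hs.1, hs.2.trans_lt hx.2⟩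
    rw [← gronwallBound_ε0]
    refine norm_le_gronwallBound_of_norm_deriv_right_le
      (fun s hs => (hf s (hsub hs)).continuousAt.continuousWithinAt)
      (fun s hs => (hf s (hsub (Ico_subset_Icc_self hs))).hasDerivWithinAt) le_rfl
      (fun s hs => ?_) x (right_mem_Icc.2 ht.2.le)
    simpa using hbound s (hsub (Ico_subset_Icc_self hs))
  have hexp : Tendsto (fun t => Real.exp (K * (x - t))) (𝓝[>] a) (𝓝 (Real.exp (K * (x - a)))) :=
    (Continuous.tendsto (by fun_prop) a).mono_left nhdsWithin_le_nhds
  have hzero : Tendsto (fun t => ‖f t‖ * Real.exp (K * (x - t))) (𝓝[>] a) (𝓝 0) := by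
    simpa using hlim.norm.mul hexp
  exact norm_le_zero_iff.1 <| ge_of_tendsto hzero <|
    eventually_of_mem (Ioo_mem_nhdsGT hx.1) hgronwall

/-- The exponent `δ` in the law `w' ≍ w ^ δ` for `w = 1 - u` near the equilibrium `1`. -/
noncomputable def slopeExponent (p β γ : ℝ) : ℝ := (γ - β + 1) / p

/-- The exponent `κ` in the law `y ≍ w ^ κ`, where `w = 1 - u` and `y` is minus the flux, near the
equilibrium `1`. -/
noncomputable def fluxExponent (p β γ : ℝ) : ℝ := γ + 1 - slopeExponent p β γ

section Exponents

variable {p β γ : ℝ}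

theorem fluxExponent_eq_div (hp : 1 < p) :
    fluxExponent p β γ = ((γ + β / (p - 1)) * (p - 1) + (p - 1)) / p := by
  have hp₁ : p - 1 ≠ 0 := by linarith
  rw [fluxExponent, slopeExponent]
  field_simp
  ring

theorem fluxExponent_pos_iff (hp : 1 < p) : 0 < fluxExponent p β γ ↔ -1 < γ + β / (p - 1) := by
  have hp₁ : 0 < p - 1 := by linarith
  rw [fluxExponent_eq_div hp, div_pos_iff_of_pos_right (by linarith), ← add_one_mul,
    mul_pos_iff_of_pos_right hp₁, neg_lt_iff_pos_add]

theorem fluxExponent_le_one_iff (hp : 1 < p) :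
    fluxExponent p β γ ≤ 1 ↔ γ + β / (p - 1) ≤ 1 / (p - 1) := by
  rw [fluxExponent_eq_div hp, div_le_one (by linarith), le_div_iff₀ (by linarith)]
  constructor <;> intro h <;> linarith

theorem rpow_mul_mul_rpow_slopeExponent (hp : 1 < p) {x R : ℝ} (hx : 0 < x) (hR : 0 ≤ R) :
    x ^ β * (R * x ^ slopeExponent p β γ) ^ (p - 1) = R ^ (p - 1) * x ^ fluxExponent p β γ := by
  have hexp : β + slopeExponent p β γ * (p - 1) = fluxExponent p β γ := by
    rw [fluxExponent, slopeExponent]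
    field_simp
    ring
  rw [Real.mul_rpow hR (by positivity), ← Real.rpow_mul hx.le, mul_left_comm, ← Real.rpow_add hx,
    hexp]

theorem rpow_fluxExponent_sub_one_mul {x : ℝ} (hx : 0 < x) :
    x ^ (fluxExponent p β γ - 1) * x ^ slopeExponent p β γ = x ^ γ := by
  rw [← Real.rpow_add hx, fluxExponent]
  congr 1
  ring

end Exponents

/-- `w` increases from the value `0` at the left end of the interval `S`, and the flux `y` is
comparable to `w ^ β * w' ^ (p - 1)` and balances a reaction comparable to `w ^ γ` up to a
convection term of size at most `C * w'`. A profile near the equilibrium `1` has this form with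
`w = 1 - u` and `y` minus its flux. The left end of `S`, finite or not, is encoded by the filter
`atBot` of the subtype `S`. -/
structure IsPowerFront (p β γ C : ℝ) (S : Set ℝ) (w y : ℝ → ℝ) : Prop where
  pos_const : 0 < C
  ordConnected : S.OrdConnected
  pos : ∀ x ∈ S, 0 < w x
  le_one : ∀ x ∈ S, w x ≤ 1
  deriv_pos : ∀ x ∈ S, 0 < deriv w x
  differentiableAt_flux : ∀ x ∈ S, DifferentiableAt ℝ y x
  le_flux : ∀ x ∈ S, C⁻¹ * (w x ^ β * deriv w x ^ (p - 1)) ≤ y x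
  flux_le : ∀ x ∈ S, y x ≤ C * (w x ^ β * deriv w x ^ (p - 1))
  le_deriv_flux : ∀ x ∈ S, C⁻¹ * w x ^ γ - C * deriv w x ≤ deriv y x
  deriv_flux_le : ∀ x ∈ S, deriv y x ≤ C * w x ^ γ + C * deriv w x
  tendsto : Tendsto (fun x : S => w x) atBot (𝓝 0)
  tendsto_flux : Tendsto (fun x : S => y x) atBot (𝓝 0)

namespace IsPowerFront

variable {p β γ C : ℝ} {S : Set ℝ} {w y : ℝ → ℝ}

theorem hasDerivAt (h : IsPowerFront p β γ C S w y) {x : ℝ} (hx : x ∈ S) :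
    HasDerivAt w (deriv w x) x :=
  (differentiableAt_of_deriv_ne_zero (h.deriv_pos x hx).ne').hasDerivAt

theorem mul_rpow_slopeExponent_le_deriv (h : IsPowerFront p β γ C S w y) (hp : 1 < p) {x R : ℝ}
    (hx : x ∈ S) (hR : 0 ≤ R) (hy : C * (R ^ (p - 1) * w x ^ fluxExponent p β γ) ≤ y x) :
    R * w x ^ slopeExponent p β γ ≤ deriv w x := by
  have hC := h.pos_const
  have hw := h.pos x hx
  have hw' := h.deriv_pos x hx
  by_contra! hlt
  have : y x < y x := calc
    y x ≤ C * (w x ^ β * deriv w x ^ (p - 1)) := h.flux_le x hx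
    _ < C * (w x ^ β * (R * w x ^ slopeExponent p β γ) ^ (p - 1)) := by gcongr
    _ ≤ y x := by rwa [rpow_mul_mul_rpow_slopeExponent hp hw hR]
  exact this.false

theorem deriv_le_mul_rpow_slopeExponent (h : IsPowerFront p β γ C S w y) (hp : 1 < p) {x R : ℝ}
    (hx : x ∈ S) (hR : 0 ≤ R) (hy : y x ≤ C⁻¹ * (R ^ (p - 1) * w x ^ fluxExponent p β γ)) :
    deriv w x ≤ R * w x ^ slopeExponent p β γ := by
  have hC := h.pos_const
  have hw := h.pos x hx
  by_contra! hlt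
  have : y x < y x := calc
    y x ≤ C⁻¹ * (w x ^ β * (R * w x ^ slopeExponent p β γ) ^ (p - 1)) := by
      rwa [rpow_mul_mul_rpow_slopeExponent hp hw hR]
    _ < C⁻¹ * (w x ^ β * deriv w x ^ (p - 1)) := by gcongr
    _ ≤ y x := h.le_flux x hx
  exact this.false

theorem deriv_le_rpow_mul_deriv (h : IsPowerFront p β γ C S w y) (hκ : fluxExponent p β γ ≤ 1)
    {x : ℝ} (hx : x ∈ S) : deriv w x ≤ w x ^ (fluxExponent p β γ - 1) * deriv w x :=
  le_mul_of_one_le_left (h.deriv_pos x hx).le <|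
    Real.one_le_rpow_of_pos_of_le_one_of_nonpos (h.pos x hx) (h.le_one x hx) (by linarith)

theorem deriv_flux_le_of_le_deriv (h : IsPowerFront p β γ C S w y)
    (hκ : fluxExponent p β γ ≤ 1) {x R : ℝ} (hx : x ∈ S) (hR : 0 < R)
    (hw' : R * w x ^ slopeExponent p β γ ≤ deriv w x) :
    deriv y x ≤ (C / R + C) * (w x ^ (fluxExponent p β γ - 1) * deriv w x) := by
  have hC := h.pos_const
  have hw := h.pos x hx
  have hle := h.deriv_le_rpow_mul_deriv hκ hx
  calc deriv y x ≤ C * w x ^ γ + C * deriv w x := h.deriv_flux_le x hx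
    _ = C / R * (w x ^ (fluxExponent p β γ - 1) * (R * w x ^ slopeExponent p β γ))
          + C * deriv w x := by
        rw [mul_left_comm _ R, rpow_fluxExponent_sub_one_mul hw, ← mul_assoc,
          div_mul_cancel₀ _ hR.ne']
    _ ≤ C / R * (w x ^ (fluxExponent p β γ - 1) * deriv w x)
          + C * (w x ^ (fluxExponent p β γ - 1) * deriv w x) := by gcongr
    _ = _ := by ring

theorem le_deriv_flux_of_deriv_le (h : IsPowerFront p β γ C S w y)
    (hκ : fluxExponent p β γ ≤ 1) {x R : ℝ} (hx : x ∈ S) (hR : 0 < R)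
    (hw' : deriv w x ≤ R * w x ^ slopeExponent p β γ) :
    (C⁻¹ / R - C) * (w x ^ (fluxExponent p β γ - 1) * deriv w x) ≤ deriv y x := by
  have hC := h.pos_const
  have hw := h.pos x hx
  have hle := h.deriv_le_rpow_mul_deriv hκ hx
  calc _ = C⁻¹ / R * (w x ^ (fluxExponent p β γ - 1) * deriv w x)
          - C * (w x ^ (fluxExponent p β γ - 1) * deriv w x) := by ring
    _ ≤ C⁻¹ / R * (w x ^ (fluxExponent p β γ - 1) * (R * w x ^ slopeExponent p β γ))
          - C * deriv w x := by gcongr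
    _ = C⁻¹ * w x ^ γ - C * deriv w x := by
        rw [mul_left_comm _ R, rpow_fluxExponent_sub_one_mul hw, ← mul_assoc,
          div_mul_cancel₀ _ hR.ne']
    _ ≤ deriv y x := h.le_deriv_flux x hx

theorem hasDerivAt_mul_rpow_fluxExponent (h : IsPowerFront p β γ C S w y) (B : ℝ) {x : ℝ}
    (hx : x ∈ S) : HasDerivAt (fun t => B * w t ^ fluxExponent p β γ)
      (B * fluxExponent p β γ * (w x ^ (fluxExponent p β γ - 1) * deriv w x)) x :=
  (((h.hasDerivAt hx).rpow_const (.inl (h.pos x hx).ne')).const_mul B).congr_deriv (by ring)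

theorem tendsto_flux_sub_mul_rpow (h : IsPowerFront p β γ C S w y) (hκ : 0 < fluxExponent p β γ)
    (B : ℝ) : Tendsto (fun x : S => y x - B * w x ^ fluxExponent p β γ) atBot (𝓝 0) := by
  simpa [Real.zero_rpow hκ.ne'] using
    h.tendsto_flux.sub ((h.tendsto.rpow_const (.inr hκ.le)).const_mul B)

theorem flux_le_mul_rpow (h : IsPowerFront p β γ C S w y) (hp : 1 < p)
    (hκ : fluxExponent p β γ ∈ Ioc 0 1) {R : ℝ} (hR : 0 < R)
    (hCR : C / R + C < C * R ^ (p - 1) * fluxExponent p β γ) {x : ℝ} (hx : x ∈ S) :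
    y x ≤ C * R ^ (p - 1) * w x ^ fluxExponent p β γ := by
  refine le_of_deriv_lt_of_tendsto_sub h.ordConnected
    (fun t ht => (h.differentiableAt_flux t ht).hasDerivAt)
    (fun t ht => h.hasDerivAt_mul_rpow_fluxExponent _ ht) (fun t ht hlt => ?_)
    (h.tendsto_flux_sub_mul_rpow hκ.1 _) hx
  have hslope := h.mul_rpow_slopeExponent_le_deriv hp ht hR.le (by linarith)
  have hpos := mul_pos (Real.rpow_pos_of_pos (h.pos t ht) (fluxExponent p β γ - 1))
    (h.deriv_pos t ht)
  exact (h.deriv_flux_le_of_le_deriv hκ.2 ht hR hslope).trans_lt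
    (mul_lt_mul_of_pos_right hCR hpos)

theorem mul_rpow_le_flux (h : IsPowerFront p β γ C S w y) (hp : 1 < p)
    (hκ : fluxExponent p β γ ∈ Ioc 0 1) {R : ℝ} (hR : 0 < R)
    (hCR : C⁻¹ * R ^ (p - 1) * fluxExponent p β γ < C⁻¹ / R - C) {x : ℝ} (hx : x ∈ S) :
    C⁻¹ * R ^ (p - 1) * w x ^ fluxExponent p β γ ≤ y x := by
  refine le_of_deriv_lt_of_tendsto_sub h.ordConnected
    (fun t ht => h.hasDerivAt_mul_rpow_fluxExponent _ ht)
    (fun t ht => (h.differentiableAt_flux t ht).hasDerivAt) (fun t ht hlt => ?_)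
    (by simpa using (h.tendsto_flux_sub_mul_rpow hκ.1 (C⁻¹ * R ^ (p - 1))).neg) hx
  have hslope := h.deriv_le_mul_rpow_slopeExponent hp ht hR.le (by linarith)
  have hpos := mul_pos (Real.rpow_pos_of_pos (h.pos t ht) (fluxExponent p β γ - 1))
    (h.deriv_pos t ht)
  exact (mul_lt_mul_of_pos_right hCR hpos).trans_le
    (h.le_deriv_flux_of_deriv_le hκ.2 ht hR hslope)

theorem exists_deriv_le (h : IsPowerFront p β γ C S w y) (hp : 1 < p)
    (hκ : fluxExponent p β γ ∈ Ioc 0 1) :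
    ∃ K, ∀ x ∈ S, deriv w x ≤ K * w x ^ slopeExponent p β γ := by
  have hC := h.pos_const
  have hp₁ : 0 < p - 1 := by linarith
  obtain ⟨R, hR, hR₁, hR₂⟩ : ∃ R > 0, C / R + C < C + 1 ∧
      C + 1 < C * R ^ (p - 1) * fluxExponent p β γ := by
    have hlim : Tendsto (fun R => C / R + C) atTop (𝓝 C) := by
      simpa using (tendsto_id.const_div_atTop C).add_const C
    have hlim' := ((tendsto_rpow_atTop hp₁).const_mul_atTop hC).atTop_mul_const hκ.1
    exact ((eventually_gt_atTop 0).and ((hlim.eventually_lt_const (lt_add_one C)).and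
      (hlim'.eventually_gt_atTop (C + 1)))).exists
  set Q := (C * C) ^ (p - 1)⁻¹
  have hQ : Q ^ (p - 1) = C * C := Real.rpow_inv_rpow (by positivity) hp₁.ne'
  refine ⟨Q * R, fun x hx => h.deriv_le_mul_rpow_slopeExponent hp hx (by positivity) ?_⟩
  calc y x ≤ C * R ^ (p - 1) * w x ^ fluxExponent p β γ :=
        h.flux_le_mul_rpow hp hκ hR (hR₁.trans hR₂) hx
    _ = C⁻¹ * ((Q * R) ^ (p - 1) * w x ^ fluxExponent p β γ) := by
        rw [Real.mul_rpow (by positivity) hR.le, hQ]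
        field_simp

theorem exists_le_deriv (h : IsPowerFront p β γ C S w y) (hp : 1 < p)
    (hκ : fluxExponent p β γ ∈ Ioc 0 1) :
    ∃ k > 0, ∀ x ∈ S, k * w x ^ slopeExponent p β γ ≤ deriv w x := by
  have hC := h.pos_const
  have hp₁ : 0 < p - 1 := by linarith
  obtain ⟨R, hR, hR₁, hR₂⟩ : ∃ R > 0, C⁻¹ * R ^ (p - 1) * fluxExponent p β γ < 1 ∧
      1 + C < C⁻¹ / R := by
    have hlim : Tendsto (fun R : ℝ => C⁻¹ * R ^ (p - 1) * fluxExponent p β γ) (𝓝[>] 0) (𝓝 0) := by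
      have := (Real.continuousAt_rpow_const 0 (p - 1) (.inr hp₁.le)).tendsto.const_mul C⁻¹
      simpa [Real.zero_rpow hp₁.ne'] using
        (this.mul_const (fluxExponent p β γ)).mono_left nhdsWithin_le_nhds
    have hlim' := tendsto_inv_nhdsGT_zero.const_mul_atTop (inv_pos.2 hC)
    exact (eventually_mem_nhdsWithin.and ((hlim.eventually_lt_const one_pos).and
      (hlim'.eventually_gt_atTop (1 + C)))).exists
  set Q := (C⁻¹ * C⁻¹) ^ (p - 1)⁻¹
  have hQ : Q ^ (p - 1) = C⁻¹ * C⁻¹ := Real.rpow_inv_rpow (by positivity) hp₁.ne'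
  refine ⟨Q * R, by positivity, fun x hx =>
    h.mul_rpow_slopeExponent_le_deriv hp hx (by positivity) ?_⟩
  calc C * ((Q * R) ^ (p - 1) * w x ^ fluxExponent p β γ)
      = C⁻¹ * R ^ (p - 1) * w x ^ fluxExponent p β γ := by
        rw [Real.mul_rpow (by positivity) hR.le, hQ]
        field_simp
    _ ≤ y x := h.mul_rpow_le_flux hp hκ hR (by linarith) hx

theorem one_le_slopeExponent {A : ℝ} (h : IsPowerFront p β γ C (Iio A) w y) (hp : 1 < p)
    (hκ : fluxExponent p β γ ∈ Ioc 0 1) : 1 ≤ slopeExponent p β γ := by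
  by_contra! hδ
  obtain ⟨k, hk, hle⟩ := h.exists_le_deriv hp hκ
  exact not_forall_mul_rpow_le_deriv h.pos hk hδ hle

theorem slopeExponent_lt_one {a b : ℝ} (hab : a < b) (h : IsPowerFront p β γ C (Ioo a b) w y)
    (hp : 1 < p) (hκ : fluxExponent p β γ ∈ Ioc 0 1) : slopeExponent p β γ < 1 := by
  by_contra! hδ
  obtain ⟨K, hle⟩ := h.exists_deriv_le hp hκ
  have hbound : ∀ x ∈ Ioo a b, ‖deriv w x‖ ≤ |K| * ‖w x‖ := fun x hx => by
    have hw := h.pos x hx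
    rw [Real.norm_of_nonneg (h.deriv_pos x hx).le, Real.norm_of_nonneg hw.le]
    calc deriv w x ≤ K * w x ^ slopeExponent p β γ := hle x hx
      _ ≤ |K| * w x ^ slopeExponent p β γ := by gcongr; exact le_abs_self K
      _ ≤ |K| * w x := by
        gcongr
        simpa using Real.rpow_le_rpow_of_exponent_ge hw (h.le_one x hx) hδ
  obtain ⟨x, hx⟩ := nonempty_Ioo.2 hab
  exact (h.pos x hx).ne' <| eq_zero_of_norm_deriv_le_of_tendsto (fun x hx => h.hasDerivAt hx)
    hbound ((tendsto_comp_coe_Ioo_atBot hab).1 h.tendsto) hx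

end IsPowerFront

theorem SimilarAlong.eventually_bounds {l : Filter ℝ} {φ₁ φ₂ : ℝ → ℝ}
    (h : SimilarAlong l φ₁ φ₂) (hpos : ∀ᶠ s in l, 0 < φ₂ s) :
    ∀ᶠ C : ℝ in atTop, ∀ᶠ s in l, C⁻¹ * φ₂ s ≤ φ₁ s ∧ φ₁ s ≤ C * φ₂ s := by
  obtain ⟨L, hL, hlim⟩ := h
  filter_upwards [tendsto_inv_atTop_zero.eventually_lt_const hL, eventually_gt_atTop L]
    with C hCL hLC
  filter_upwards [hpos, hlim.eventually_const_lt hCL, hlim.eventually_lt_const hLC]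
    with s hs hl hr
  exact ⟨((lt_div_iff₀ hs).1 hl).le, ((div_lt_iff₀ hs).1 hr).le⟩

/-- On `(r, 1)` the diffusion `D` and the reaction `g` are comparable to powers of the distance to
`1`, and the convection coefficient `b` is bounded, all with the same constant `C`. -/
structure PowerLawCoeffs (β γ C r : ℝ) (D g b : ℝ → ℝ) : Prop where
  pos_const : 0 < C
  mem_Ico : r ∈ Ico (0 : ℝ) 1
  le_diffusion : ∀ v ∈ Ioo r 1, C⁻¹ * (1 - v) ^ β ≤ D v
  diffusion_le : ∀ v ∈ Ioo r 1, D v ≤ C * (1 - v) ^ β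
  le_reaction : ∀ v ∈ Ioo r 1, C⁻¹ * (1 - v) ^ γ ≤ g v
  reaction_le : ∀ v ∈ Ioo r 1, g v ≤ C * (1 - v) ^ γ
  abs_convection_le : ∀ v ∈ Ioo r 1, |b v| ≤ C

namespace PowerLawCoeffs

variable {β γ C r : ℝ} {D g b : ℝ → ℝ}

theorem diffusion_pos (h : PowerLawCoeffs β γ C r D g b) : ∀ v ∈ Ioo r 1, 0 < D v := fun v hv =>
  (mul_pos (inv_pos.2 h.pos_const) (Real.rpow_pos_of_pos (sub_pos.2 hv.2) β)).trans_le
    (h.le_diffusion v hv)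

theorem reaction_pos (h : PowerLawCoeffs β γ C r D g b) : ∀ v ∈ Ioo r 1, 0 < g v := fun v hv =>
  (mul_pos (inv_pos.2 h.pos_const) (Real.rpow_pos_of_pos (sub_pos.2 hv.2) γ)).trans_le
    (h.le_reaction v hv)

theorem exists_of_similarAlong (hD : SimilarAlong (𝓝[<] 1) D (fun v => (1 - v) ^ β))
    (hg : SimilarAlong (𝓝[<] 1) g (fun v => (1 - v) ^ γ)) (hb : ContinuousOn b (Icc 0 1)) :
    ∃ C r, PowerLawCoeffs β γ C r D g b := by
  have hpow : ∀ s : ℝ, ∀ᶠ v in 𝓝[<] (1 : ℝ), 0 < (1 - v) ^ s := fun s =>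
    eventually_nhdsWithin_of_forall fun v hv => Real.rpow_pos_of_pos (sub_pos.2 hv) s
  obtain ⟨M, hM⟩ := isCompact_Icc.exists_bound_of_continuousOn hb
  obtain ⟨C, hCD, hCg, hMC, hC⟩ := ((hD.eventually_bounds (hpow β)).and
    ((hg.eventually_bounds (hpow γ)).and
      ((eventually_ge_atTop M).and (eventually_gt_atTop 0)))).exists
  obtain ⟨r, hr, hsub⟩ :=
    (mem_nhdsLT_iff_exists_mem_Ico_Ioo_subset zero_lt_one).1 (hCD.and hCg)
  exact ⟨C, r,
    { pos_const := hC
      mem_Ico := hr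
      le_diffusion := fun v hv => (hsub hv).1.1
      diffusion_le := fun v hv => (hsub hv).1.2
      le_reaction := fun v hv => (hsub hv).2.1
      reaction_le := fun v hv => (hsub hv).2.2
      abs_convection_le := fun v hv => (hM v ⟨hr.1.trans hv.1.le, hv.2.le⟩).trans hMC }⟩

end PowerLawCoeffs

theorem continuousOn_convVelocity {H : ℝ → ℝ} (hH : ContDiffOn ℝ 1 H (Icc 0 1)) :
    ContinuousOn (convVelocity H) (Icc 0 1) :=
  hH.continuousOn_derivWithin (uniqueDiffOn_Icc zero_lt_one) le_rfl

section WaveFlux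

variable {p ξ : ℝ} {D u : ℝ → ℝ}

theorem sign_waveFlux (hD : 0 < D (u ξ)) :
    SignType.sign (waveFlux p D u ξ) = SignType.sign (deriv u ξ) := by
  rcases eq_or_ne (deriv u ξ) 0 with h | h
  · simp [waveFlux, h]
  · have : 0 < D (u ξ) * |deriv u ξ| ^ (p - 2) :=
      mul_pos hD (Real.rpow_pos_of_pos (abs_pos.2 h) _)
    rw [waveFlux, sign_mul, sign_pos this, one_mul]

theorem neg_waveFlux_of_deriv_neg (h : deriv u ξ < 0) :
    -waveFlux p D u ξ = D (u ξ) * (-deriv u ξ) ^ (p - 1) := by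
  have hpow : (-deriv u ξ) ^ (p - 1) = (-deriv u ξ) ^ (p - 2) * -deriv u ξ := by
    rw [← Real.rpow_add_one (by linarith)]
    congr 1
    ring
  rw [waveFlux, abs_of_neg h, hpow]
  ring

end WaveFlux

namespace IsWaveProfile

variable {p c r : ℝ} {D H g u : ℝ → ℝ}

theorem mem_transitionSet (hr : 0 ≤ r) {ξ : ℝ} (hξ : u ξ ∈ Ioo r 1) : ξ ∈ transitionSet u :=
  ⟨hr.trans_lt hξ.1, hξ.2⟩

/-- At a critical point the equation reads `(flux)' = -g < 0`, and the flux has the sign of `u'`. -/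
theorem eventually_lt_of_deriv_eq_zero (hu : IsWaveProfile p c D H g u) (hr : 0 ≤ r)
    (hD : ∀ v ∈ Ioo r 1, 0 < D v) (hg : ∀ v ∈ Ioo r 1, 0 < g v) {ξ : ℝ} (hξ : u ξ ∈ Ioo r 1)
    (hcrit : deriv u ξ = 0) : ∀ᶠ x in 𝓝[<] ξ, u x < u ξ := by
  have hflux : waveFlux p D u ξ = 0 := by simp [waveFlux, hcrit]
  have hflux' : deriv (waveFlux p D u) ξ < 0 := by
    have heq := hu.equation ξ (mem_transitionSet hr hξ)
    rw [hcrit, mul_zero, add_zero] at heq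
    linarith [hg _ hξ]
  have hnear : ∀ᶠ x in 𝓝 ξ, u x ∈ Ioo r 1 :=
    hu.continuous.continuousAt.eventually (isOpen_Ioo.mem_nhds hξ)
  have hsign : ∀ᶠ x in 𝓝 ξ, SignType.sign (deriv u x) = SignType.sign (ξ - x) := by
    filter_upwards [hnear, eventually_nhdsWithin_sign_eq_of_deriv_neg hflux' hflux] with x hx hsx
    rw [← sign_waveFlux (hD _ hx), hsx]
  obtain ⟨a, ha, hpos⟩ := mem_nhdsLT_iff_exists_Ioo_subset.1
    (deriv_pos_left_of_sign_deriv (hsign.filter_mono nhdsWithin_le_nhds))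
  have hmono : StrictMonoOn u (Ioc a ξ) :=
    strictMonoOn_of_deriv_pos (convex_Ioc a ξ) hu.continuous.continuousOn
      (by rw [interior_Ioc]; exact fun x hx => hpos hx)
  filter_upwards [Ioo_mem_nhdsLT ha] with x hx
  exact hmono (Ioo_subset_Ioc_self hx) (right_mem_Ioc.2 ha) hx.2

/-- Otherwise `u` would have a local minimum with value in `(r, 1)`. -/
theorem antitoneOn (hu : IsWaveProfile p c D H g u) (hr : 0 ≤ r) (hD : ∀ v ∈ Ioo r 1, 0 < D v)
    (hg : ∀ v ∈ Ioo r 1, 0 < g v) {I : Set ℝ} (hI : I.OrdConnected) (hrI : ∀ x ∈ I, r < u x)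
    (hleft : ∀ x ∈ I, u x < 1 → ∃ z ∈ I, z < x ∧ u x < u z) : AntitoneOn u I := by
  intro x hx y hy hxy
  by_contra! hlt
  obtain ⟨z, hz, hzx, hxz⟩ := hleft x hx (hlt.trans_le (hu.mem_Icc y).2)
  obtain ⟨m, hm, hmin⟩ := isCompact_Icc.exists_isMinOn (nonempty_Icc.2 (hzx.le.trans hxy))
    hu.continuous.continuousOn
  have hmx : u m ≤ u x := hmin ⟨hzx.le, hxy⟩
  have hzm : z < m := lt_of_le_of_ne hm.1 (by rintro rfl; linarith)
  have hmy : m < y := lt_of_le_of_ne hm.2 (by rintro rfl; linarith)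
  have hmr : u m ∈ Ioo r 1 :=
    ⟨hrI m (hI.out hz hy hm), hmx.trans_lt (hlt.trans_le (hu.mem_Icc y).2)⟩
  have hcrit := (hmin.isLocalMin (Icc_mem_nhds hzm hmy)).deriv_eq_zero
  obtain ⟨t, htm, ht⟩ := ((hu.eventually_lt_of_deriv_eq_zero hr hD hg hmr hcrit).and
    (Ioo_mem_nhdsLT hzm)).exists
  exact htm.not_ge (hmin ⟨ht.1.le, (ht.2.trans hmy).le⟩)

theorem deriv_neg_of_antitoneOn (hu : IsWaveProfile p c D H g u) (hr : 0 ≤ r)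
    (hD : ∀ v ∈ Ioo r 1, 0 < D v) (hg : ∀ v ∈ Ioo r 1, 0 < g v) {S : Set ℝ} {ξ : ℝ}
    (hS : S ∈ 𝓝 ξ) (hanti : AntitoneOn u S) (hξ : u ξ ∈ Ioo r 1) : deriv u ξ < 0 := by
  refine lt_of_le_of_ne ?_ fun hcrit => ?_
  · rw [← derivWithin_of_mem_nhds hS]
    exact hanti.derivWithin_nonpos
  · obtain ⟨x, hlt, hxξ, hxS⟩ := ((hu.eventually_lt_of_deriv_eq_zero hr hD hg hξ hcrit).and
      (eventually_mem_nhdsWithin.and (mem_nhdsWithin_of_mem_nhds hS))).exists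
    exact hlt.not_ge (hanti hxS (mem_of_mem_nhds hS) (le_of_lt hxξ))

theorem isPowerFront {β γ C : ℝ} (hu : IsWaveProfile p c D H g u)
    (hcoeff : PowerLawCoeffs β γ C r D g (fun v => c + convVelocity H v)) {S : Set ℝ}
    (hS : S.OrdConnected) (hSo : IsOpen S) (hrS : ∀ x ∈ S, u x ∈ Ioo r 1)
    (hanti : AntitoneOn u S) (hlim : Tendsto (fun x : S => u x) atBot (𝓝 1)) :
    IsPowerFront p β γ C S (fun x => 1 - u x) (fun x => -waveFlux p D u x) := by
  have hmem : ∀ x ∈ S, x ∈ transitionSet u := fun x hx =>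
    mem_transitionSet hcoeff.mem_Ico.1 (hrS x hx)
  have hneg : ∀ x ∈ S, deriv u x < 0 := fun x hx =>
    hu.deriv_neg_of_antitoneOn hcoeff.mem_Ico.1 hcoeff.diffusion_pos hcoeff.reaction_pos
      (hSo.mem_nhds hx) hanti (hrS x hx)
  have hslope : ∀ x ∈ S, 0 ≤ (-deriv u x) ^ (p - 1) := fun x hx =>
    Real.rpow_nonneg (neg_nonneg.2 (hneg x hx).le) _
  have hconv : ∀ x ∈ S, |(c + convVelocity H (u x)) * deriv u x| ≤ C * -deriv u x := fun x hx => by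
    rw [abs_mul, abs_of_neg (hneg x hx)]
    exact mul_le_mul_of_nonneg_right (hcoeff.abs_convection_le _ (hrS x hx))
      (neg_nonneg.2 (hneg x hx).le)
  exact
    { pos_const := hcoeff.pos_const
      ordConnected := hS
      pos := fun x hx => sub_pos.2 (hrS x hx).2
      le_one := fun x _ => sub_le_self 1 (hu.mem_Icc x).1
      deriv_pos := fun x hx => by simpa using hneg x hx
      differentiableAt_flux := fun x hx => (hu.flux_differentiableAt x (hmem x hx)).neg
      le_flux := fun x hx => by
        rw [neg_waveFlux_of_deriv_neg (hneg x hx), deriv_const_sub, ← mul_assoc]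
        exact mul_le_mul_of_nonneg_right (hcoeff.le_diffusion _ (hrS x hx)) (hslope x hx)
      flux_le := fun x hx => by
        rw [neg_waveFlux_of_deriv_neg (hneg x hx), deriv_const_sub, ← mul_assoc]
        exact mul_le_mul_of_nonneg_right (hcoeff.diffusion_le _ (hrS x hx)) (hslope x hx)
      le_deriv_flux := fun x hx => by
        rw [deriv.fun_neg, deriv_const_sub]
        linarith [hu.equation x (hmem x hx), hcoeff.le_reaction _ (hrS x hx),
          (abs_le.1 (hconv x hx)).1]
      deriv_flux_le := fun x hx => by
        rw [deriv.fun_neg, deriv_const_sub]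
        linarith [hu.equation x (hmem x hx), hcoeff.reaction_le _ (hrS x hx),
          (abs_le.1 (hconv x hx)).2]
      tendsto := by simpa using hlim.const_sub 1
      tendsto_flux := by simpa using (hu.flux_one.comp (tendsto_comap_iff.2 hlim)).neg }

theorem exists_forall_le_eq_one {β γ C : ℝ} (hu : IsWaveProfile p c D H g u) (hp : 1 < p)
    (hκ : fluxExponent p β γ ∈ Ioc 0 1)
    (hcoeff : PowerLawCoeffs β γ C r D g (fun v => c + convVelocity H v))
    (hδ : slopeExponent p β γ < 1) : ∃ ξ, ∀ x ≤ ξ, u x = 1 := by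
  obtain ⟨A, hA⟩ := eventually_atBot.1 (hu.tendsto_atBot.eventually_const_lt hcoeff.mem_Ico.2)
  have hanti : AntitoneOn u (Iic A) := by
    refine hu.antitoneOn hcoeff.mem_Ico.1 hcoeff.diffusion_pos hcoeff.reaction_pos ordConnected_Iic
      hA fun x hx hx₁ => ?_
    obtain ⟨z, hxz, hzx⟩ :=
      ((hu.tendsto_atBot.eventually_const_lt hx₁).and (eventually_lt_atBot x)).exists
    exact ⟨z, hzx.le.trans hx, hzx, hxz⟩
  by_contra! hlt
  have hlt' : ∀ x ≤ A, u x < 1 := fun x hx => by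
    obtain ⟨t, htx, ht⟩ := hlt x
    exact (hanti (htx.trans hx) hx htx).trans_lt (lt_of_le_of_ne (hu.mem_Icc t).2 ht)
  have hfront := hu.isPowerFront hcoeff (S := Iio A) ordConnected_Iio isOpen_Iio
    (fun x hx => ⟨hA x (le_of_lt hx), hlt' x (le_of_lt hx)⟩) (hanti.mono Iio_subset_Iic_self)
    (tendsto_comp_val_Iio_atBot.2 hu.tendsto_atBot)
  exact hδ.not_ge (hfront.one_le_slopeExponent hp hκ)

theorem exists_isGreatest_eq_one (hu : IsWaveProfile p c D H g u) {ξ : ℝ} (hξ : u ξ = 1) :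
    ∃ a, IsGreatest {x | u x = 1} a := by
  obtain ⟨B, hB⟩ := eventually_atTop.1 (hu.tendsto_atTop.eventually_lt_const one_pos)
  exact ⟨_, (isClosed_eq hu.continuous continuous_const).isGreatest_csSup ⟨ξ, hξ⟩
    ⟨B, fun x hx => le_of_not_ge fun hBx => (hB x hBx).ne hx⟩⟩

theorem lt_one {β γ C : ℝ} (hu : IsWaveProfile p c D H g u) (hp : 1 < p)
    (hκ : fluxExponent p β γ ∈ Ioc 0 1)
    (hcoeff : PowerLawCoeffs β γ C r D g (fun v => c + convVelocity H v))
    (hδ : 1 ≤ slopeExponent p β γ) (ξ : ℝ) : u ξ < 1 := by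
  refine lt_of_le_of_ne (hu.mem_Icc ξ).2 fun hξ => ?_
  obtain ⟨a, ha, hgreatest⟩ := hu.exists_isGreatest_eq_one hξ
  have ha : u a = 1 := ha
  have hlt : ∀ x, a < x → u x < 1 := fun x hx =>
    lt_of_le_of_ne (hu.mem_Icc x).2 fun h => (hgreatest h).not_gt hx
  have hnear : ∀ᶠ x in 𝓝[≥] a, r < u x := nhdsWithin_le_nhds
    (hu.continuous.continuousAt.eventually_const_lt (ha ▸ hcoeff.mem_Ico.2))
  obtain ⟨b, hab, hb⟩ := mem_nhdsGE_iff_exists_Ico_subset.1 hnear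
  have hanti : AntitoneOn u (Ico a b) :=
    hu.antitoneOn hcoeff.mem_Ico.1 hcoeff.diffusion_pos hcoeff.reaction_pos ordConnected_Ico
      (fun x hx => hb hx) fun x hx hx₁ =>
        ⟨a, left_mem_Ico.2 hab, lt_of_le_of_ne hx.1 (by rintro rfl; exact hx₁.ne ha), ha ▸ hx₁⟩
  have hlim : Tendsto u (𝓝[>] a) (𝓝 1) :=
    ha ▸ hu.continuous.continuousAt.tendsto.mono_left nhdsWithin_le_nhds
  have hfront := hu.isPowerFront hcoeff (S := Ioo a b) ordConnected_Ioo isOpen_Ioo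
    (fun x hx => ⟨hb (Ioo_subset_Ico_self hx), hlt x hx.1⟩) (hanti.mono Ioo_subset_Ico_self)
    ((tendsto_comp_coe_Ioo_atBot hab).2 hlim)
  exact hδ.not_gt (hfront.slopeExponent_lt_one hab hp hκ)

theorem exists_mem_transitionSet (hu : IsWaveProfile p c D H g u) {x y : ℝ} (hx : u x = 1)
    (hxy : x ≤ y) (hy : u y < 1) : ∃ z ∈ transitionSet u, z ≤ y := by
  have hy₀ := (hu.mem_Icc y).1
  obtain ⟨z, hz, hzu⟩ := intermediate_value_Icc' hxy hu.continuous.continuousOn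
    (show (u y + 1) / 2 ∈ Icc (u y) (u x) by constructor <;> linarith)
  exact ⟨z, by constructor <;> linarith, hz.2⟩

theorem exists_leftEndpoint_eq_coe (hu : IsWaveProfile p c D H g u) {ξ : ℝ}
    (hξ : ∀ x ≤ ξ, u x = 1) : ∃ a : ℝ, leftEndpoint u = a ∧ ∀ x ≤ a, u x = 1 := by
  have hbdd : BddBelow (transitionSet u) :=
    ⟨ξ, fun x hx => le_of_not_ge fun hxξ => hx.2.ne (hξ x hxξ)⟩
  have hne : (transitionSet u).Nonempty := by
    obtain ⟨y, hy, hξy⟩ :=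
      ((hu.tendsto_atTop.eventually_lt_const one_pos).and (eventually_ge_atTop ξ)).exists
    obtain ⟨z, hz, -⟩ := hu.exists_mem_transitionSet (hξ ξ le_rfl) hξy hy
    exact ⟨z, hz⟩
  refine ⟨sInf (transitionSet u), (Monotone.map_csInf_of_continuousAt
    continuous_coe_real_ereal.continuousAt EReal.coe_strictMono.monotone hne hbdd).symm, ?_⟩
  have hlt : ∀ x < sInf (transitionSet u), u x = 1 := fun x hx => by
    by_contra hx₁
    obtain ⟨z, hz, hzx⟩ := hu.exists_mem_transitionSet (hξ _ (min_le_left ξ x))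
      (min_le_right ξ x) (lt_of_le_of_ne (hu.mem_Icc x).2 hx₁)
    exact (csInf_le hbdd hz).not_gt (hzx.trans_lt hx)
  intro x hx
  have hclosure : x ∈ closure (Iio (sInf (transitionSet u))) := by rwa [closure_Iio]
  exact closure_minimal hlt (isClosed_eq hu.continuous continuous_const) hclosure

theorem leftEndpoint_eq_bot (hu : IsWaveProfile p c D H g u) (hlt : ∀ ξ, u ξ < 1) :
    leftEndpoint u = ⊥ := by
  refine (EReal.eq_bot_iff_forall_lt _).2 fun y => ?_
  obtain ⟨x, hx, hxy⟩ :=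
    ((hu.tendsto_atBot.eventually_const_lt one_pos).and (eventually_lt_atBot y)).exists
  exact (sInf_le (mem_image_of_mem _ (show x ∈ transitionSet u from ⟨hx, hlt x⟩))).trans_lt
    (EReal.coe_lt_coe_iff.2 hxy)

end IsWaveProfile

theorem theorem4_general {p c β γ : ℝ} {D H g u : ℝ → ℝ} (hp : 1 < p)
    (hH : ContDiffOn ℝ 1 H (Icc 0 1)) (hu : IsWaveProfile p c D H g u)
    (hDβ : SimilarAlong (𝓝[<] 1) D (fun v => (1 - v) ^ β))
    (hgγ : SimilarAlong (𝓝[<] 1) g (fun v => (1 - v) ^ γ))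
    (hlow : -1 < γ + β / (p - 1)) (hupp : γ + β / (p - 1) ≤ 1 / (p - 1)) :
    ((γ - β + 1) / p < 1 →
      ∃ a : ℝ, leftEndpoint u = (a : EReal) ∧ ∀ ξ ≤ a, u ξ = 1) ∧
    (1 ≤ (γ - β + 1) / p →
      leftEndpoint u = ⊥ ∧ ∀ ξ, u ξ < 1) := by
  have hκ : fluxExponent p β γ ∈ Ioc 0 1 :=
    ⟨(fluxExponent_pos_iff hp).2 hlow, (fluxExponent_le_one_iff hp).2 hupp⟩
  obtain ⟨C, r, hcoeff⟩ := PowerLawCoeffs.exists_of_similarAlong hDβ hgγ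
    (continuousOn_const.add (continuousOn_convVelocity hH) :
      ContinuousOn (fun v => c + convVelocity H v) (Icc 0 1))
  refine ⟨fun hδ => ?_, fun hδ => ?_⟩
  · obtain ⟨ξ, hξ⟩ := hu.exists_forall_le_eq_one hp hκ hcoeff hδ
    exact hu.exists_leftEndpoint_eq_coe hξ
  · have hlt := hu.lt_one hp hκ hcoeff hδ
    exact ⟨hu.leftEndpoint_eq_bot hlt, hlt⟩

theorem theorem4
    (p θ c β γ : ℝ) (D H g u : ℝ → ℝ)
    (hp : 1 < p)
    (hθ : θ ∈ Ioo (0 : ℝ) 1)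
    -- diffusion coefficient
    (hD : ContDiffOn ℝ 1 D (Ioo 0 1))
    (hDpos : ∀ v ∈ Ioo (0 : ℝ) 1, 0 < D v)
    -- convective flux
    (hH : ContDiffOn ℝ 1 H (Icc 0 1))
    (hHzero : H 0 = 0)
    (hHpos : ∀ v ∈ Ioc (0 : ℝ) 1, 0 < H v)
    -- combustion-type reaction
    (hg : ContinuousOn g (Icc 0 1))
    (hgzero : ∀ v ∈ Icc (0 : ℝ) θ, g v = 0)
    (hgpos : ∀ v ∈ Ioo θ 1, 0 < g v)
    (hgone : g 1 = 0)
    -- travelling wave profile with positive speed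
    (hc : 0 < c)
    (hu : IsWaveProfile p c D H g u)
    -- power-type behaviour near the equilibrium 1
    (hγ : 0 < γ)
    (hDβ : SimilarAlong (𝓝[<] 1) D (fun v => (1 - v) ^ β))
    (hgγ : SimilarAlong (𝓝[<] 1) g (fun v => (1 - v) ^ γ))
    (hlow : -1 < γ + β / (p - 1))
    (hupp : γ + β / (p - 1) ≤ 1 / (p - 1)) :
    ((γ - β + 1) / p < 1 →
      ∃ a : ℝ, leftEndpoint u = (a : EReal) ∧ ∀ ξ ≤ a, u ξ = 1) ∧
    (1 ≤ (γ - β + 1) / p →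
      leftEndpoint u = ⊥ ∧ ∀ ξ, u ξ < 1) := by
  exact theorem4_general hp hH hu hDβ hgγ hlow hupp
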